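/- Let $(X,g_X)$ and $(B,g_B)$ be finite-dimensional smooth Riemannian manifolds (without boundary), and let $\pi\colon X\to B$ be a Riemannian submersion, i.e. a smooth map such that for every $x\in X$ the differential $d\pi_x\colon T_xX\to T_{\pi(x)}B$ is surjective and restricts to a linear isometry on the horizontal space $\mathcal H_x=(\ker d\pi_x)^{\perp}\subset T_xX$. If every sectional curvature of $B$ is non-positive, then for every $x\in X$ and all linearly independent $u,v\in\mathcal H_x$, the sectional curvature of $X$ at $x$ along the plane spanned by $u$ and $v$ is non-positive. -/

import Mathlib

open scoped Manifold ContDiff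

noncomputable section

namespace RiemannianGeometry

/-- A smooth Riemannian metric on a manifold `M` without boundary modelled on the normed
space `E`: a smooth family of inner products on the tangent spaces of `M`. -/
abbrev Metric (E : Type*) [NormedAddCommGroup E] [NormedSpace ℝ E]
    (M : Type*) [TopologicalSpace M] [ChartedSpace E M] [IsManifold 𝓘(ℝ, E) ∞ M] :=
  Bundle.ContMDiffRiemannianMetric 𝓘(ℝ, E) ∞ E (fun x : M ↦ TangentSpace 𝓘(ℝ, E) x)

section Chart

/-! ### The Levi-Civita connection and its curvature on an open subset of a vector space

Here `G` is a field of bilinear forms on the vector space `E`; it is only used near points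
where it is smooth, symmetric and positive definite. -/

variable {E : Type*} [NormedAddCommGroup E] [NormedSpace ℝ E]

/-- Christoffel symbols of the first kind, as a linear form in the third argument `w`:
`(∂_u G(v, w) + ∂_v G(u, w) - ∂_w G(u, v)) / 2`. -/
def christoffelLower (G : E → E →L[ℝ] E →L[ℝ] ℝ) (y u v : E) : E →L[ℝ] ℝ :=
  (1 / 2 : ℝ) • (fderiv ℝ G y u v + fderiv ℝ G y v u - ((fderiv ℝ G y).flip u).flip v)

/-- Christoffel symbols of the second kind: `christoffel G y u v` is the vector `Γ` with
`G y Γ w = christoffelLower G y u v w` for all `w` (if `G y` is nondegenerate). This is the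
Levi-Civita derivative at `y` of the constant vector field `v` in the direction `u`. -/
def christoffel (G : E → E →L[ℝ] E →L[ℝ] ℝ) (y u v : E) : E :=
  (G y).inverse (christoffelLower G y u v)

/-- The curvature `R(u, v) w = ∇_u ∇_v w - ∇_v ∇_u w` of the Levi-Civita connection of `G`
at `y`, for constant (hence commuting) vector fields `u`, `v`, `w`. -/
def chartCurvature (G : E → E →L[ℝ] E →L[ℝ] ℝ) (y u v w : E) : E :=
  fderiv ℝ (fun z ↦ christoffel G z v w) y u - fderiv ℝ (fun z ↦ christoffel G z u w) y v
    + christoffel G y u (christoffel G y v w) - christoffel G y v (christoffel G y u w)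

end Chart

section Manifold

variable {E : Type*} [NormedAddCommGroup E] [NormedSpace ℝ E]
  {M : Type*} [TopologicalSpace M] [ChartedSpace E M] [IsManifold 𝓘(ℝ, E) ∞ M]

/-- The expression of the metric `g` in the preferred chart `φ` around `x`: at the point `y` of
the vector space `E`, this is the bilinear form `(u, v) ↦ g (d(φ⁻¹)_y u) (d(φ⁻¹)_y v)`. -/
def chartMetric (g : Metric E M) (x : M) (y : E) : E →L[ℝ] E →L[ℝ] ℝ :=
  (ContinuousLinearMap.precomp ℝ
      (mfderiv 𝓘(ℝ, E) 𝓘(ℝ, E) (extChartAt 𝓘(ℝ, E) x).symm y)).comp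
    ((g.inner ((extChartAt 𝓘(ℝ, E) x).symm y)).comp
      (mfderiv 𝓘(ℝ, E) 𝓘(ℝ, E) (extChartAt 𝓘(ℝ, E) x).symm y))

/-- The coordinates of a tangent vector at `x` in the preferred chart around `x`. -/
def chartVector (x : M) (u : TangentSpace 𝓘(ℝ, E) x) : E :=
  mfderiv 𝓘(ℝ, E) 𝓘(ℝ, E) (extChartAt 𝓘(ℝ, E) x) x u

/-- The number `g(R(u, v) v, u)`, where `R` is the Riemann curvature tensor of `g` at `x`,
computed in the preferred chart around `x`. -/
def curvatureForm (g : Metric E M) (x : M) (u v : TangentSpace 𝓘(ℝ, E) x) : ℝ :=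
  chartMetric g x (extChartAt 𝓘(ℝ, E) x x)
    (chartCurvature (chartMetric g x) (extChartAt 𝓘(ℝ, E) x x)
      (chartVector x u) (chartVector x v) (chartVector x v))
    (chartVector x u)

/-- The sectional curvature at `x` of the plane spanned by two linearly independent tangent
vectors `u` and `v`. -/
def sectionalCurvature (g : Metric E M) (x : M) (u v : TangentSpace 𝓘(ℝ, E) x) : ℝ :=
  curvatureForm g x u v / (g.inner x u u * g.inner x v v - g.inner x u v ^ 2)

/-- All sectional curvatures of the Riemannian manifold `(M, g)` are non-positive. -/
def NonposSectionalCurvature (g : Metric E M) : Prop :=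
  ∀ (x : M) (u v : TangentSpace 𝓘(ℝ, E) x),
    LinearIndependent ℝ ![u, v] → sectionalCurvature g x u v ≤ 0

end Manifold

section Submersion

variable {E : Type*} [NormedAddCommGroup E] [NormedSpace ℝ E]
  {X : Type*} [TopologicalSpace X] [ChartedSpace E X] [IsManifold 𝓘(ℝ, E) ∞ X]
  {F : Type*} [NormedAddCommGroup F] [NormedSpace ℝ F]
  {B : Type*} [TopologicalSpace B] [ChartedSpace F B] [IsManifold 𝓘(ℝ, F) ∞ B]

/-- The horizontal space of `π : X → B` at `x`: the orthogonal complement, with respect to the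
metric of `X`, of the vertical space `ker (dπ_x)`. -/
def horizontalSpace (F : Type*) [NormedAddCommGroup F] [NormedSpace ℝ F]
    {B : Type*} [TopologicalSpace B] [ChartedSpace F B]
    (gX : Metric E X) (π : X → B) (x : X) : Submodule ℝ (TangentSpace 𝓘(ℝ, E) x) where
  carrier := {u | ∀ w : TangentSpace 𝓘(ℝ, E) x,
    mfderiv 𝓘(ℝ, E) 𝓘(ℝ, F) π x w = 0 → gX.inner x u w = 0}
  zero_mem' := by intro w _; simp
  add_mem' := by intro u v hu hv w hw; simp [hu w hw, hv w hw]
  smul_mem' := by intro c u hu w hw; simp [hu w hw]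

/-- `π : X → B` is a Riemannian submersion: it is smooth, its differentials are surjective, and
they are isometric on the horizontal spaces. -/
structure IsRiemannianSubmersion (gX : Metric E X) (gB : Metric F B) (π : X → B) : Prop where
  contMDiff : ContMDiff 𝓘(ℝ, E) 𝓘(ℝ, F) ∞ π
  surjective_mfderiv : ∀ x : X, Function.Surjective (mfderiv 𝓘(ℝ, E) 𝓘(ℝ, F) π x)
  inner_mfderiv : ∀ x : X, ∀ u ∈ horizontalSpace F gX π x, ∀ v ∈ horizontalSpace F gX π x,
    gB.inner (π x) (mfderiv 𝓘(ℝ, E) 𝓘(ℝ, F) π x u) (mfderiv 𝓘(ℝ, E) 𝓘(ℝ, F) π x v)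
      = gX.inner x u v

end Submersion

end RiemannianGeometry

end

/-!
The theorem follows from O'Neill's formula: for horizontal `u`, `v` the curvature form of `X` at
`(u, v)` is the curvature form of `B` at `(dπ u, dπ v)` minus `3 |W|²`, where `W` is the vertical
part of the covariant derivative `∇_X Y` of horizontal lifts `X`, `Y` (half of their bracket).

Everything is proved for metrics `G` on `U ⊆ E` and `H` on `V ⊆ F` and a Riemannian submersion
`p : U → V`, and transported to manifolds through the preferred charts. The horizontal lift is
the adjoint of `dp`, `G (lift b) w = H b (dp w)`, so it is a smooth field of linear maps.
Differentiating this identity shows that, for all `u` and `w`,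
`G (∇_u (lift β)) w = H (∇_{dp u} β) (dp w) + H β (II u w)`,
where `II = ∇ dp` is the second fundamental form of the map `p`
(`IsRiemannianSubmersionOn.inner_covDeriv_lift`). The form `II` is symmetric, and `II u` is
skew-adjoint on horizontal vectors because `dp ∘ lift = id`; hence `II` vanishes on pairs of
horizontal vectors (`secondFundamentalForm_lift_lift`). With `X = lift a` and `Y = lift b` for
constant `a`, `b`, these facts give `∇_Y Y = lift (∇_b b)`, `∇_X Y = lift (∇_a b) + W` with `W`
vertical, `[X, Y] = 2 W`, and `G (∇_Y W) X = G (∇_W Y) X = G W W`. Substituting into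
`R(X, Y) Y = ∇_X ∇_Y Y - ∇_Y ∇_X Y - ∇_{[X, Y]} Y` (`ricci_identity`) yields
`exists_curvatureTensor_lift`.

Finally `dπ` is injective on horizontal spaces, so `dπ u` and `dπ v` span a plane; by the strict
Cauchy-Schwarz inequality the denominators of the sectional curvatures are positive, and the signs
of the sectional curvatures are those of the curvature forms.
-/

namespace RiemannianGeometry

section LocalCalculus

/-! ### Connections and metrics on open subsets of a vector space -/

variable {E : Type*} [NormedAddCommGroup E] [NormedSpace ℝ E]
-- needed to find the norm on trilinear maps `E →L[ℝ] E →L[ℝ] E →L[ℝ] ℝ`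
set_option maxSynthPendingDepth 4

/-- `G` is a smooth Riemannian metric on the open subset `U` of the vector space `E`. -/
structure IsMetricOn (G : E → E →L[ℝ] E →L[ℝ] ℝ) (U : Set E) : Prop where
  isOpen : IsOpen U
  contDiffOn : ContDiffOn ℝ ∞ G U
  symm : ∀ y ∈ U, ∀ u v, G y u v = G y v u
  pos : ∀ y ∈ U, ∀ u, u ≠ 0 → 0 < G y u u

/-- The Christoffel symbols of the second kind, bundled as a continuous bilinear map, so that their
derivative in the base point makes sense as a trilinear map. -/
noncomputable def christoffelCLM (G : E → E →L[ℝ] E →L[ℝ] ℝ) (y : E) : E →L[ℝ] E →L[ℝ] E :=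
  (ContinuousLinearMap.compL ℝ E (E →L[ℝ] ℝ) E (G y).inverse).comp
    ((1 / 2 : ℝ) • (fderiv ℝ G y + (fderiv ℝ G y).flip -
      (ContinuousLinearMap.flipₗᵢ ℝ E E ℝ : (E →L[ℝ] E →L[ℝ] ℝ) →L[ℝ] E →L[ℝ] E →L[ℝ] ℝ).comp
        (fderiv ℝ G y).flip))

theorem christoffelCLM_apply (G : E → E →L[ℝ] E →L[ℝ] ℝ) (y u v : E) :
    christoffelCLM G y u v = christoffel G y u v := by
  rfl

/-- The covariant derivative at `y` of the vector field `Y` in the direction `u`, for the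
connection with Christoffel symbols `Γ`. -/
noncomputable def covDeriv (Γ : E → E →L[ℝ] E →L[ℝ] E) (u : E) (Y : E → E) (y : E) : E :=
  fderiv ℝ Y y u + Γ y u (Y y)

theorem covDeriv_add {Γ : E → E →L[ℝ] E →L[ℝ] E} {Y Z : E → E} {y : E}
    (hY : DifferentiableAt ℝ Y y) (hZ : DifferentiableAt ℝ Z y) (u : E) :
    covDeriv Γ u (fun z ↦ Y z + Z z) y = covDeriv Γ u Y y + covDeriv Γ u Z y := by
  simp only [covDeriv, fderiv_fun_add hY hZ, map_add, add_apply]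
  abel

/-- The curvature tensor `R(u, v) w` at `y` of the connection with Christoffel symbols `Γ`. -/
noncomputable def curvatureTensor (Γ : E → E →L[ℝ] E →L[ℝ] E) (y u v w : E) : E :=
  fderiv ℝ Γ y u v w - fderiv ℝ Γ y v u w + Γ y u (Γ y v w) - Γ y v (Γ y u w)

theorem fderiv_clm_apply₂ {E₁ E₂ E₃ E₄ : Type*} [NormedAddCommGroup E₁] [NormedSpace ℝ E₁]
    [NormedAddCommGroup E₂] [NormedSpace ℝ E₂] [NormedAddCommGroup E₃] [NormedSpace ℝ E₃]
    [NormedAddCommGroup E₄] [NormedSpace ℝ E₄]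
    {T : E₁ → E₂ →L[ℝ] E₃ →L[ℝ] E₄} {Y : E₁ → E₂} {Z : E₁ → E₃} {y : E₁}
    (hT : DifferentiableAt ℝ T y) (hY : DifferentiableAt ℝ Y y) (hZ : DifferentiableAt ℝ Z y)
    (u : E₁) :
    fderiv ℝ (fun z ↦ T z (Y z) (Z z)) y u =
      fderiv ℝ T y u (Y y) (Z y) + T y (fderiv ℝ Y y u) (Z y) + T y (Y y) (fderiv ℝ Z y u) := by
  rw [fderiv_clm_apply (hT.clm_apply hY) hZ, fderiv_clm_apply hT hY]
  simp
  abel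

theorem curvatureTensor_christoffelCLM {G : E → E →L[ℝ] E →L[ℝ] ℝ} {y : E}
    (h : DifferentiableAt ℝ (christoffelCLM G) y) (u v w : E) :
    curvatureTensor (christoffelCLM G) y u v w = chartCurvature G y u v w := by
  have key (a b : E) : fderiv ℝ (fun z ↦ christoffel G z a w) y b
      = fderiv ℝ (christoffelCLM G) y b a w := by
    have := fderiv_clm_apply₂ h (differentiableAt_const a) (differentiableAt_const w) b
    simpa only [christoffelCLM_apply, fderiv_fun_const, Pi.zero_apply, zero_apply, map_zero,
      add_zero] using this
  simp only [curvatureTensor, chartCurvature, key, christoffelCLM_apply]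

theorem differentiableAt_covDeriv {Γ : E → E →L[ℝ] E →L[ℝ] E} {Y Z : E → E} {y : E}
    (hΓ : DifferentiableAt ℝ Γ y) (hY : DifferentiableAt ℝ Y y) (hZ : ContDiffAt ℝ 2 Z y) :
    DifferentiableAt ℝ (fun z ↦ covDeriv Γ (Y z) Z z) y := by
  have h1 : DifferentiableAt ℝ (fderiv ℝ Z) y :=
    (hZ.fderiv_right (m := 1) (by norm_num)).differentiableAt (by norm_num)
  exact (h1.clm_apply hY).add ((hΓ.clm_apply hY).clm_apply (hZ.differentiableAt (by norm_num)))

/-- The Ricci identity `∇_Y ∇_Z W - ∇_Z ∇_Y W - ∇_{[Y, Z]} W = R(Y, Z) W` for vector fields which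
need not be constant; it expresses that the curvature is a tensor. -/
theorem ricci_identity {Γ : E → E →L[ℝ] E →L[ℝ] E} {Y Z W : E → E} {y : E}
    (hΓ : DifferentiableAt ℝ Γ y) (hY : DifferentiableAt ℝ Y y) (hZ : DifferentiableAt ℝ Z y)
    (hW : ContDiffAt ℝ 2 W y) :
    covDeriv Γ (Y y) (fun z ↦ covDeriv Γ (Z z) W z) y
      - covDeriv Γ (Z y) (fun z ↦ covDeriv Γ (Y z) W z) y
      - covDeriv Γ (fderiv ℝ Z y (Y y) - fderiv ℝ Y y (Z y)) W y
      = curvatureTensor Γ y (Y y) (Z y) (W y) := by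
  have hW1 : DifferentiableAt ℝ W y := hW.differentiableAt (by norm_num)
  have hW2 : DifferentiableAt ℝ (fderiv ℝ W) y :=
    (hW.fderiv_right (m := 1) (by norm_num)).differentiableAt (by norm_num)
  have hsymm : fderiv ℝ (fderiv ℝ W) y (Y y) (Z y) = fderiv ℝ (fderiv ℝ W) y (Z y) (Y y) :=
    (hW.isSymmSndFDerivAt (by simp)).eq _ _
  have key {V : E → E} (hV : DifferentiableAt ℝ V y) (u : E) :
      fderiv ℝ (fun z ↦ covDeriv Γ (V z) W z) y u
        = fderiv ℝ (fderiv ℝ W) y u (V y) + fderiv ℝ W y (fderiv ℝ V y u)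
          + (fderiv ℝ Γ y u (V y) (W y) + Γ y (fderiv ℝ V y u) (W y)
            + Γ y (V y) (fderiv ℝ W y u)) := by
    unfold covDeriv
    rw [fderiv_fun_add (hW2.clm_apply hV) ((hΓ.clm_apply hV).clm_apply hW1), add_apply,
      fderiv_clm_apply₂ hΓ hV hW1, fderiv_clm_apply hW2 hV]
    simp
    abel
  rw [covDeriv, covDeriv, covDeriv, key hZ, key hY, hsymm, curvatureTensor]
  simp only [covDeriv, map_add, map_sub, sub_apply]
  abel

theorem IsMetricOn.mono {G : E → E →L[ℝ] E →L[ℝ] ℝ} {U U' : Set E} (hG : IsMetricOn G U)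
    (hU' : IsOpen U') (h : U' ⊆ U) : IsMetricOn G U' where
  isOpen := hU'
  contDiffOn := hG.contDiffOn.mono h
  symm y hy := hG.symm y (h hy)
  pos y hy := hG.pos y (h hy)

theorem IsMetricOn.differentiableAt {G : E → E →L[ℝ] E →L[ℝ] ℝ} {U : Set E}
    (hG : IsMetricOn G U) {y : E} (hy : y ∈ U) : DifferentiableAt ℝ G y :=
  (hG.contDiffOn.contDiffAt (hG.isOpen.mem_nhds hy)).differentiableAt (by simp)

theorem IsMetricOn.fderiv_symm {G : E → E →L[ℝ] E →L[ℝ] ℝ} {U : Set E}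
    (hG : IsMetricOn G U) {y : E} (hy : y ∈ U)
    (u v w : E) :
    fderiv ℝ G y u v w = fderiv ℝ G y u w v := by
  have key (v w : E) : fderiv ℝ (fun z ↦ G z v w) y u = fderiv ℝ G y u v w := by
    simpa using fderiv_clm_apply₂ (hG.differentiableAt hy) (differentiableAt_const v)
      (differentiableAt_const w) u
  rw [← key, ← key]
  congr 1
  apply Filter.EventuallyEq.fderiv_eq
  filter_upwards [hG.isOpen.mem_nhds hy] with z hz using hG.symm z hz v w

section Metric

variable [FiniteDimensional ℝ E] {G : E → E →L[ℝ] E →L[ℝ] ℝ} {U : Set E}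

namespace IsMetricOn

theorem exists_equiv (hG : IsMetricOn G U) {y : E} (hy : y ∈ U) :
    ∃ e : E ≃L[ℝ] (E →L[ℝ] ℝ), (e : E →L[ℝ] E →L[ℝ] ℝ) = G y := by
  have hinj : Function.Injective (G y : E →ₗ[ℝ] E →L[ℝ] ℝ) := by
    refine (injective_iff_map_eq_zero _).2 fun u hu ↦ ?_
    by_contra hne
    have := hG.pos y hy u hne
    have h0 : G y u = 0 := hu
    simp [h0] at this
  have hfin : Module.finrank ℝ E = Module.finrank ℝ (E →L[ℝ] ℝ) := by
    rw [← (LinearMap.toContinuousLinearMap (𝕜 := ℝ) (E := E) (F' := ℝ)).finrank_eq]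
    exact (Subspace.dual_finrank_eq (K := ℝ) (V := E)).symm
  refine ⟨(LinearEquiv.ofInjectiveOfFinrankEq _ hinj hfin).toContinuousLinearEquiv, ?_⟩
  ext u v
  rfl

theorem isInvertible (hG : IsMetricOn G U) {y : E} (hy : y ∈ U) : (G y).IsInvertible :=
  hG.exists_equiv hy

theorem apply_inverse (hG : IsMetricOn G U) {y : E} (hy : y ∈ U) (l : E →L[ℝ] ℝ) :
    G y ((G y).inverse l) = l := by
  exact (hG.isInvertible hy).self_apply_inverse l

theorem ext (hG : IsMetricOn G U) {y : E} (hy : y ∈ U) {u v : E}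
    (h : ∀ w, G y u w = G y v w) : u = v :=
  (hG.isInvertible hy).injective (ContinuousLinearMap.ext h)

theorem contDiffOn_inverse (hG : IsMetricOn G U) :
    ContDiffOn ℝ ∞ (fun y ↦ (G y).inverse) U := by
  intro y hy
  obtain ⟨e, he⟩ := hG.exists_equiv hy
  have := contDiffAt_map_inverse (n := ∞) e
  rw [he] at this
  exact this.comp_contDiffWithinAt y (hG.contDiffOn y hy)

theorem contDiffOn_christoffelCLM (hG : IsMetricOn G U) :
    ContDiffOn ℝ ∞ (christoffelCLM G) U := by
  have h1 : ContDiffOn ℝ ∞ (fderiv ℝ G) U :=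
    hG.contDiffOn.fderiv_of_isOpen hG.isOpen (by simp)
  have h2 : ContDiffOn ℝ ∞ (fun y ↦ (fderiv ℝ G y).flip) U :=
    (ContinuousLinearMap.flipₗᵢ ℝ E E (E →L[ℝ] ℝ)).contDiff.comp_contDiffOn h1
  have h3 : ContDiffOn ℝ ∞ (fun y ↦ ContinuousLinearMap.compL ℝ E (E →L[ℝ] ℝ) E (G y).inverse) U :=
    (ContinuousLinearMap.compL ℝ E (E →L[ℝ] ℝ) E).contDiff.comp_contDiffOn hG.contDiffOn_inverse
  exact h3.clm_comp (((h1.add h2).sub (contDiffOn_const.clm_comp h2)).const_smul _)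

theorem differentiableAt_christoffelCLM (hG : IsMetricOn G U) {y : E} (hy : y ∈ U) :
    DifferentiableAt ℝ (christoffelCLM G) y :=
  (hG.contDiffOn_christoffelCLM.contDiffAt (hG.isOpen.mem_nhds hy)).differentiableAt (by simp)

theorem christoffelCLM_inner (hG : IsMetricOn G U) {y : E} (hy : y ∈ U) (u v w : E) :
    G y (christoffelCLM G y u v) w
      = (1 / 2 : ℝ) * (fderiv ℝ G y u v w + fderiv ℝ G y v u w - fderiv ℝ G y w u v) := by
  rw [christoffelCLM_apply, christoffel, hG.apply_inverse hy]
  simp [christoffelLower]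

/-- The Levi-Civita connection is torsion-free. -/
theorem christoffelCLM_symm (hG : IsMetricOn G U) {y : E} (hy : y ∈ U) (u v : E) :
    christoffelCLM G y u v = christoffelCLM G y v u := by
  refine hG.ext hy fun w ↦ ?_
  rw [hG.christoffelCLM_inner hy, hG.christoffelCLM_inner hy, hG.fderiv_symm hy w u v]
  ring

/-- The Levi-Civita connection is compatible with the metric, for constant vector fields. -/
theorem fderiv_apply (hG : IsMetricOn G U) {y : E} (hy : y ∈ U) (u v w : E) :
    fderiv ℝ G y u v w = G y (christoffelCLM G y u v) w + G y v (christoffelCLM G y u w) := by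
  rw [hG.symm y hy v, hG.christoffelCLM_inner hy, hG.christoffelCLM_inner hy,
    hG.fderiv_symm hy u w, hG.fderiv_symm hy w, hG.fderiv_symm hy v]
  ring

/-- The Levi-Civita connection is compatible with the metric. -/
theorem fderiv_inner (hG : IsMetricOn G U) {y : E} (hy : y ∈ U) {Y Z : E → E}
    (hY : DifferentiableAt ℝ Y y) (hZ : DifferentiableAt ℝ Z y) (u : E) :
    fderiv ℝ (fun z ↦ G z (Y z) (Z z)) y u
      = G y (covDeriv (christoffelCLM G) u Y y) (Z y)
        + G y (Y y) (covDeriv (christoffelCLM G) u Z y) := by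
  rw [fderiv_clm_apply₂ (hG.differentiableAt hy) hY hZ, hG.fderiv_apply hy]
  simp only [covDeriv, map_add, add_apply]
  ring

end IsMetricOn

end Metric

end LocalCalculus

section LocalSubmersion

/-! ### O'Neill's formula on open subsets of vector spaces -/

variable {E : Type*} [NormedAddCommGroup E] [NormedSpace ℝ E]
  {F : Type*} [NormedAddCommGroup F] [NormedSpace ℝ F]

-- as above, for trilinear maps
set_option maxSynthPendingDepth 4

theorem two_le_infty : (2 : WithTop ℕ∞) ≤ ∞ := by
  exact ENat.LEInfty.out

/-- `p` is a Riemannian submersion from the open subset `U` of the vector space `E` with the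
metric `G` to the open subset `V` of the vector space `F` with the metric `H`. -/
structure IsRiemannianSubmersionOn (G : E → E →L[ℝ] E →L[ℝ] ℝ) (U : Set E)
    (H : F → F →L[ℝ] F →L[ℝ] ℝ) (V : Set F) (p : E → F) : Prop where
  metric_source : IsMetricOn G U
  metric_target : IsMetricOn H V
  contDiffOn : ContDiffOn ℝ ∞ p U
  mapsTo : Set.MapsTo p U V
  surjective : ∀ y ∈ U, Function.Surjective (fderiv ℝ p y)
  isometric : ∀ y ∈ U, ∀ u v : E, (∀ w, fderiv ℝ p y w = 0 → G y u w = 0) →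
    (∀ w, fderiv ℝ p y w = 0 → G y v w = 0) →
    H (p y) (fderiv ℝ p y u) (fderiv ℝ p y v) = G y u v

/-- The horizontal lift at `y` of tangent vectors at `p y`: the adjoint of the differential of `p`,
determined by `G y (horizontalLift G H p y b) w = H (p y) b (fderiv ℝ p y w)`. -/
noncomputable def horizontalLift (G : E → E →L[ℝ] E →L[ℝ] ℝ) (H : F → F →L[ℝ] F →L[ℝ] ℝ)
    (p : E → F) (y : E) : F →L[ℝ] E :=
  (G y).inverse.comp ((ContinuousLinearMap.precomp ℝ (fderiv ℝ p y)).comp (H (p y)))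

/-- The second fundamental form of the map `p`, i.e. the covariant derivative of its
differential. -/
noncomputable def secondFundamentalForm (G : E → E →L[ℝ] E →L[ℝ] ℝ) (H : F → F →L[ℝ] F →L[ℝ] ℝ)
    (p : E → F) (y u w : E) : F :=
  fderiv ℝ (fderiv ℝ p) y u w + christoffelCLM H (p y) (fderiv ℝ p y u) (fderiv ℝ p y w)
    - fderiv ℝ p y (christoffelCLM G y u w)

namespace IsRiemannianSubmersionOn

variable {G : E → E →L[ℝ] E →L[ℝ] ℝ} {U : Set E} {H : F → F →L[ℝ] F →L[ℝ] ℝ} {V : Set F} {p : E → F}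

local notation "lift" => horizontalLift G H p
local notation "II" => secondFundamentalForm G H p

theorem contDiffOn_fderiv (h : IsRiemannianSubmersionOn G U H V p) :
    ContDiffOn ℝ ∞ (fderiv ℝ p) U :=
  h.contDiffOn.fderiv_of_isOpen h.metric_source.isOpen (by simp)

theorem differentiableAt_of_contDiffOn {A : Type*} [NormedAddCommGroup A] [NormedSpace ℝ A]
    (h : IsRiemannianSubmersionOn G U H V p) {f : E → A} (hf : ContDiffOn ℝ ∞ f U) {y : E}
    (hy : y ∈ U) : DifferentiableAt ℝ f y :=
  (hf.contDiffAt (h.metric_source.isOpen.mem_nhds hy)).differentiableAt (by simp)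

variable [FiniteDimensional ℝ E]

theorem inner_lift (h : IsRiemannianSubmersionOn G U H V p) {y : E} (hy : y ∈ U) (b : F) (w : E) :
    G y (lift y b) w = H (p y) b (fderiv ℝ p y w) := by
  simp only [horizontalLift, ContinuousLinearMap.comp_apply]
  rw [h.metric_source.apply_inverse hy]
  rfl

theorem contDiffOn_lift (h : IsRiemannianSubmersionOn G U H V p) :
    ContDiffOn ℝ ∞ lift U := by
  have h1 : ContDiffOn ℝ ∞ (fun y ↦ ContinuousLinearMap.precomp ℝ (fderiv ℝ p y)) U :=
    ((ContinuousLinearMap.compL ℝ E F ℝ).flip).contDiff.comp_contDiffOn h.contDiffOn_fderiv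
  exact h.metric_source.contDiffOn_inverse.clm_comp
    (h1.clm_comp (h.metric_target.contDiffOn.comp h.contDiffOn h.mapsTo))

theorem differentiableAt_lift (h : IsRiemannianSubmersionOn G U H V p) {y : E} (hy : y ∈ U)
    {β : F → F} (hβ : DifferentiableAt ℝ β (p y)) :
    DifferentiableAt ℝ (fun z ↦ lift z (β (p z))) y :=
  (h.differentiableAt_of_contDiffOn h.contDiffOn_lift hy).clm_apply
    (hβ.comp y (h.differentiableAt_of_contDiffOn h.contDiffOn hy))

variable [FiniteDimensional ℝ F]

/-- Horizontal lifts project back: `P = dp ∘ lift` satisfies `H (P c) (P d) = H c (P d)` by the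
isometry condition, and it is surjective, being injective by surjectivity of `dp`. -/
theorem fderiv_lift (h : IsRiemannianSubmersionOn G U H V p) {y : E} (hy : y ∈ U) (b : F) :
    fderiv ℝ p y (lift y b) = b := by
  have hG := h.metric_source
  have hH := h.metric_target
  have hpy := h.mapsTo hy
  have hhor (c : F) (w : E) (hw : fderiv ℝ p y w = 0) : G y (lift y c) w = 0 := by
    rw [h.inner_lift hy, hw, map_zero]
  set P : F →L[ℝ] F := (fderiv ℝ p y).comp (lift y)
  have hPapply (c : F) : P c = fderiv ℝ p y (lift y c) := rfl
  have hPP (c d : F) : H (p y) (P c) (P d) = H (p y) c (P d) := by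
    rw [hPapply, hPapply, h.isometric y hy _ _ (hhor c) (hhor d), h.inner_lift hy]
  have hinj : Function.Injective (P : F →ₗ[ℝ] F) := by
    refine (injective_iff_map_eq_zero _).2 fun c hc ↦ ?_
    have hc' : fderiv ℝ p y (lift y c) = 0 := hc
    have hlift : lift y c = 0 := by
      by_contra hne
      have h1 := hG.pos y hy _ hne
      rw [h.inner_lift hy, hc', map_zero] at h1
      exact lt_irrefl _ h1
    by_contra hne
    have h1 := hH.pos _ hpy _ hne
    obtain ⟨w, hw⟩ := h.surjective y hy c
    have h2 := h.inner_lift hy c w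
    rw [hw, hlift] at h2
    simp only [map_zero, zero_apply] at h2
    exact h1.ne h2
  have hsurj := LinearMap.surjective_of_injective hinj
  refine hH.ext hpy fun w ↦ ?_
  obtain ⟨d, rfl⟩ := hsurj w
  exact hPP b d

/-- A horizontal vector `u` is the lift of its image: the difference is both horizontal and
vertical. -/
theorem lift_fderiv (h : IsRiemannianSubmersionOn G U H V p) {y : E} (hy : y ∈ U) {u : E}
    (hu : ∀ w, fderiv ℝ p y w = 0 → G y u w = 0) : lift y (fderiv ℝ p y u) = u := by
  have hz : fderiv ℝ p y (u - lift y (fderiv ℝ p y u)) = 0 := by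
    rw [map_sub, h.fderiv_lift hy, sub_self]
  rw [eq_comm, ← sub_eq_zero]
  by_contra hne
  have h1 := h.metric_source.pos y hy _ hne
  rw [map_sub (G y), sub_apply, h.inner_lift hy, hu _ hz, hz, map_zero, sub_zero] at h1
  exact lt_irrefl _ h1

/-- The covariant derivative of the lift of a vector field `β` is the lift of the covariant
derivative of `β`, up to the adjoint of the second fundamental form of the submersion. -/
theorem inner_covDeriv_lift (h : IsRiemannianSubmersionOn G U H V p) {y : E} (hy : y ∈ U)
    {β : F → F} (hβ : DifferentiableAt ℝ β (p y)) (u w : E) :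
    G y (covDeriv (christoffelCLM G) u (fun z ↦ lift z (β (p z))) y) w
      = H (p y) (covDeriv (christoffelCLM H) (fderiv ℝ p y u) β (p y)) (fderiv ℝ p y w)
        + H (p y) (β (p y)) (II y u w) := by
  have hp := h.differentiableAt_of_contDiffOn h.contDiffOn hy
  have hdp := h.differentiableAt_of_contDiffOn h.contDiffOn_fderiv hy
  have hHp := h.metric_target.differentiableAt (h.mapsTo hy)
  have e1 := h.metric_source.fderiv_inner hy (h.differentiableAt_lift hy hβ)
    (differentiableAt_const w) u
  have e2 : fderiv ℝ (fun z ↦ G z (lift z (β (p z))) w) y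
      = fderiv ℝ (fun z ↦ H (p z) (β (p z)) (fderiv ℝ p z w)) y := by
    apply Filter.EventuallyEq.fderiv_eq
    filter_upwards [h.metric_source.isOpen.mem_nhds hy] with z hz using h.inner_lift hz _ _
  have e3 := fderiv_clm_apply₂ (T := fun z ↦ H (p z)) (Y := fun z ↦ β (p z))
    (Z := fun z ↦ fderiv ℝ p z w) (hHp.comp y hp) (hβ.comp y hp)
    (hdp.clm_apply (differentiableAt_const w)) u
  have e4 : fderiv ℝ (fun z ↦ H (p z)) y u = fderiv ℝ H (p y) (fderiv ℝ p y u) := by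
    rw [fderiv_fun_comp y hHp hp]; rfl
  have e5 : fderiv ℝ (fun z ↦ β (p z)) y u = fderiv ℝ β (p y) (fderiv ℝ p y u) := by
    rw [fderiv_fun_comp y hβ hp]; rfl
  have e6 : fderiv ℝ (fun z ↦ fderiv ℝ p z w) y u = fderiv ℝ (fderiv ℝ p) y u w := by
    rw [fderiv_clm_apply hdp (differentiableAt_const w)]; simp
  have e7 : covDeriv (christoffelCLM G) u (fun _ ↦ w) y = christoffelCLM G y u w := by
    simp [covDeriv]
  rw [e2, e3, e4, e5, e6, e7, h.metric_target.fderiv_apply (h.mapsTo hy), h.inner_lift hy] at e1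
  simp only [covDeriv, secondFundamentalForm, map_add, map_sub, add_apply] at e1 ⊢
  linarith

theorem inner_covDeriv_lift_const (h : IsRiemannianSubmersionOn G U H V p) {y : E} (hy : y ∈ U)
    (b : F) (u w : E) :
    G y (covDeriv (christoffelCLM G) u (fun z ↦ lift z b) y) w
      = H (p y) (christoffelCLM H (p y) (fderiv ℝ p y u) b) (fderiv ℝ p y w)
        + H (p y) b (II y u w) := by
  have := h.inner_covDeriv_lift hy (differentiableAt_const b) u w
  simpa [covDeriv] using this

theorem secondFundamentalForm_symm (h : IsRiemannianSubmersionOn G U H V p) {y : E} (hy : y ∈ U)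
    (u w : E) : II y u w = II y w u := by
  have h1 : fderiv ℝ (fderiv ℝ p) y u w = fderiv ℝ (fderiv ℝ p) y w u :=
    ((h.contDiffOn.contDiffAt (h.metric_source.isOpen.mem_nhds hy)).isSymmSndFDerivAt
      (by simpa using two_le_infty)).eq _ _
  rw [secondFundamentalForm, secondFundamentalForm, h1,
    h.metric_target.christoffelCLM_symm (h.mapsTo hy), h.metric_source.christoffelCLM_symm hy]

/-- For every `u`, the second fundamental form `II u` is skew-adjoint on horizontal vectors, since
the differential of `p` is isometric on them. -/
theorem secondFundamentalForm_skew (h : IsRiemannianSubmersionOn G U H V p) {y : E} (hy : y ∈ U)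
    (u : E) (b c : F) :
    H (p y) c (II y u (lift y b)) = - H (p y) b (II y u (lift y c)) := by
  have hdp := h.differentiableAt_of_contDiffOn h.contDiffOn_fderiv hy
  have hl := h.differentiableAt_lift hy (differentiableAt_const b)
  have e1 : fderiv ℝ (fun z ↦ fderiv ℝ p z (lift z b)) y = fderiv ℝ (fun _ ↦ b) y := by
    apply Filter.EventuallyEq.fderiv_eq
    filter_upwards [h.metric_source.isOpen.mem_nhds hy] with z hz using h.fderiv_lift hz b
  have e2 := congrArg (fun L ↦ L u) e1
  simp only [fderiv_clm_apply hdp hl, fderiv_fun_const, Pi.zero_apply, zero_apply, add_apply,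
    ContinuousLinearMap.comp_apply, ContinuousLinearMap.flip_apply] at e2
  have e3 := h.inner_covDeriv_lift_const hy b u (lift y c)
  rw [h.metric_source.symm y hy, h.inner_lift hy, h.fderiv_lift hy] at e3
  have e4 : fderiv ℝ p y (covDeriv (christoffelCLM G) u (fun z ↦ lift z b) y)
      = christoffelCLM H (p y) (fderiv ℝ p y u) b - II y u (lift y b) := by
    rw [secondFundamentalForm, h.fderiv_lift hy, covDeriv, map_add, eq_neg_of_add_eq_zero_left e2]
    abel
  rw [e4, map_sub, h.metric_target.symm _ (h.mapsTo hy) _ c] at e3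
  linarith

/-- The second fundamental form of a Riemannian submersion vanishes on pairs of horizontal vectors:
`(a, b, c) ↦ H c (II (lift a) (lift b))` is symmetric in `a`, `b` and skew in `b`, `c`. -/
theorem secondFundamentalForm_lift_lift (h : IsRiemannianSubmersionOn G U H V p) {y : E}
    (hy : y ∈ U) (a b : F) : II y (lift y a) (lift y b) = 0 := by
  have hsymm (a b c : F) : H (p y) c (II y (lift y a) (lift y b))
      = H (p y) c (II y (lift y b) (lift y a)) := by rw [h.secondFundamentalForm_symm hy]
  refine h.metric_target.ext (h.mapsTo hy) fun c ↦ ?_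
  rw [h.metric_target.symm _ (h.mapsTo hy), map_zero, zero_apply]
  have h1 := h.secondFundamentalForm_skew hy (lift y a) b c
  have h2 := h.secondFundamentalForm_skew hy (lift y b) c a
  have h3 := h.secondFundamentalForm_skew hy (lift y c) a b
  have h4 := hsymm a b c
  have h5 := hsymm b c a
  have h6 := hsymm c a b
  linarith

/-- **O'Neill's formula** in local form. The vector `W` is the vertical part of `∇_X Y`, where `X`
and `Y` are the horizontal lifts of the constant vector fields `a` and `b`. -/
theorem exists_curvatureTensor_lift (h : IsRiemannianSubmersionOn G U H V p) {y : E} (hy : y ∈ U)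
    (a b : F) : ∃ W : E,
    G y (curvatureTensor (christoffelCLM G) y (lift y a) (lift y b) (lift y b)) (lift y a)
      = H (p y) (curvatureTensor (christoffelCLM H) (p y) a b b) a - 3 * G y W W := by
  have hG := h.metric_source
  have hH := h.metric_target
  have hpy := h.mapsTo hy
  have hU := hG.isOpen.mem_nhds hy
  set ΓG := christoffelCLM G
  set ΓH := christoffelCLM H
  have hΓGd : DifferentiableAt ℝ ΓG y := hG.differentiableAt_christoffelCLM hy
  have hΓHd : DifferentiableAt ℝ ΓH (p y) := hH.differentiableAt_christoffelCLM hpy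
  have hXd : DifferentiableAt ℝ (fun z ↦ lift z a) y :=
    h.differentiableAt_lift hy (differentiableAt_const a)
  have hYc : ContDiffAt ℝ 2 (fun z ↦ lift z b) y :=
    ((h.contDiffOn_lift.contDiffAt hU).of_le two_le_infty).clm_apply contDiffAt_const
  have hYd := hYc.differentiableAt (by norm_num)
  have hβ (c d : F) : DifferentiableAt ℝ (fun q ↦ ΓH q c d) (p y) :=
    (hΓHd.clm_apply (differentiableAt_const c)).clm_apply (differentiableAt_const d)
  have hcongr {Z Z' : E → E} (u : E) (hZ : ∀ z ∈ U, Z z = Z' z) :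
      covDeriv ΓG u Z y = covDeriv ΓG u Z' y := by
    have : Z =ᶠ[nhds y] Z' := Filter.eventuallyEq_of_mem hU hZ
    rw [covDeriv, covDeriv, this.fderiv_eq, this.eq_of_nhds]
  -- `∇_Y Y` is horizontal
  have hYY : ∀ z ∈ U, covDeriv ΓG (lift z b) (fun z ↦ lift z b) z = lift z (ΓH (p z) b b) := by
    intro z hz
    refine hG.ext hz fun w ↦ ?_
    have h1 := h.secondFundamentalForm_skew hz w b b
    rw [h.inner_covDeriv_lift_const hz, h.fderiv_lift hz, h.inner_lift hz,
      h.secondFundamentalForm_symm hz]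
    linarith
  -- `W` is the vertical part of `∇_X Y`
  set W : E → E := fun z ↦
    covDeriv ΓG (lift z a) (fun z ↦ lift z b) z - lift z (ΓH (p z) a b) with hW
  have hWd : DifferentiableAt ℝ W y :=
    (differentiableAt_covDeriv hΓGd hXd hYc).sub (h.differentiableAt_lift hy (hβ a b))
  have hWinner : ∀ z ∈ U, ∀ w, G z (W z) w = H (p z) b (II z (lift z a) w) := by
    intro z hz w
    rw [hW]
    simp only [map_sub, sub_apply]
    rw [h.inner_covDeriv_lift_const hz, h.fderiv_lift hz, h.inner_lift hz]
    ring
  have hWX : ∀ z ∈ U, G z (W z) (lift z a) = 0 := by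
    intro z hz
    rw [hWinner z hz, h.secondFundamentalForm_lift_lift hz, map_zero]
  have hpW : fderiv ℝ p y (W y) = 0 := by
    refine hH.ext hpy fun c ↦ ?_
    rw [hH.symm _ hpy, ← h.inner_lift hy, hG.symm _ hy, hWinner y hy,
      h.secondFundamentalForm_lift_lift hy]
    simp
  have hskew (w : E) : H (p y) a (II y (lift y b) w) = - H (p y) b (II y (lift y a) w) := by
    rw [h.secondFundamentalForm_symm hy, h.secondFundamentalForm_skew hy,
      h.secondFundamentalForm_symm hy]
  -- `[X, Y] = 2 W`
  have hbracket : fderiv ℝ (fun z ↦ lift z b) y (lift y a)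
      - fderiv ℝ (fun z ↦ lift z a) y (lift y b) = (2 : ℝ) • W y := by
    have h1 : fderiv ℝ (fun z ↦ lift z b) y (lift y a) - fderiv ℝ (fun z ↦ lift z a) y (lift y b)
        = covDeriv ΓG (lift y a) (fun z ↦ lift z b) y
          - covDeriv ΓG (lift y b) (fun z ↦ lift z a) y := by
      rw [covDeriv, covDeriv, hG.christoffelCLM_symm hy (lift y a)]
      abel
    rw [h1]
    refine hG.ext hy fun w ↦ ?_
    simp only [map_sub, sub_apply, map_smul, smul_apply, smul_eq_mul]
    rw [h.inner_covDeriv_lift_const hy, h.inner_covDeriv_lift_const hy, hWinner y hy,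
      h.fderiv_lift hy, h.fderiv_lift hy, hH.christoffelCLM_symm hpy b a, hskew]
    ring
  -- differentiate `G W X = 0` along `Y`
  have hYW : G y (covDeriv ΓG (lift y b) W y) (lift y a) = G y (W y) (W y) := by
    have h1 := hG.fderiv_inner hy hWd hXd (lift y b)
    have h2 : fderiv ℝ (fun z ↦ G z (W z) (lift z a)) y = fderiv ℝ (fun _ ↦ (0 : ℝ)) y :=
      Filter.EventuallyEq.fderiv_eq (Filter.eventuallyEq_of_mem hU hWX)
    rw [h2, hG.symm y hy (W y), h.inner_covDeriv_lift_const hy, hpW, hskew,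
      ← hWinner y hy] at h1
    simp only [fderiv_fun_const, Pi.zero_apply, zero_apply, map_zero] at h1
    linarith
  have hWY : G y (covDeriv ΓG (W y) (fun z ↦ lift z b) y) (lift y a) = G y (W y) (W y) := by
    rw [h.inner_covDeriv_lift_const hy, hpW, h.secondFundamentalForm_symm hy, ← hWinner y hy]
    simp
  have hsmul : covDeriv ΓG ((2 : ℝ) • W y) (fun z ↦ lift z b) y
      = (2 : ℝ) • covDeriv ΓG (W y) (fun z ↦ lift z b) y := by
    simp only [covDeriv, map_smul, smul_apply, smul_add]
  have hXY : covDeriv ΓG (lift y b)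
        (fun z ↦ covDeriv ΓG (lift z a) (fun z ↦ lift z b) z) y
      = covDeriv ΓG (lift y b) (fun z ↦ lift z (ΓH (p z) a b)) y
        + covDeriv ΓG (lift y b) W y := by
    rw [← covDeriv_add (h.differentiableAt_lift hy (hβ a b)) hWd]
    exact hcongr _ fun z _ ↦ by simp only [hW]; abel
  have hΓderiv (c d e : F) : covDeriv ΓH c (fun q ↦ ΓH q d e) (p y)
      = fderiv ℝ ΓH (p y) c d e + ΓH (p y) c (ΓH (p y) d e) := by
    have := fderiv_clm_apply₂ hΓHd (differentiableAt_const d) (differentiableAt_const e) c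
    simp only [fderiv_fun_const, Pi.zero_apply, zero_apply, map_zero, add_zero] at this
    rw [covDeriv, this]
  refine ⟨W y, ?_⟩
  rw [← ricci_identity hΓGd hXd hYd hYc, hbracket, hsmul, hXY, hcongr _ hYY]
  simp only [map_sub, map_add, map_smul, sub_apply, add_apply, smul_apply, smul_eq_mul]
  rw [hYW, hWY, h.inner_covDeriv_lift hy (hβ b b), h.inner_covDeriv_lift hy (hβ a b),
    h.secondFundamentalForm_lift_lift hy, h.secondFundamentalForm_lift_lift hy,
    h.fderiv_lift hy, h.fderiv_lift hy, hΓderiv, hΓderiv]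
  simp only [curvatureTensor, map_sub, map_add, sub_apply, add_apply, map_zero]
  ring

/-- A Riemannian submersion does not decrease the curvature of horizontal planes. -/
theorem inner_chartCurvature_le (h : IsRiemannianSubmersionOn G U H V p) {y : E} (hy : y ∈ U)
    {u v : E} (hu : ∀ w, fderiv ℝ p y w = 0 → G y u w = 0)
    (hv : ∀ w, fderiv ℝ p y w = 0 → G y v w = 0) :
    G y (chartCurvature G y u v v) u
      ≤ H (p y) (chartCurvature H (p y) (fderiv ℝ p y u) (fderiv ℝ p y v) (fderiv ℝ p y v))
        (fderiv ℝ p y u) := by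
  obtain ⟨W, hW⟩ := h.exists_curvatureTensor_lift hy (fderiv ℝ p y u) (fderiv ℝ p y v)
  rw [h.lift_fderiv hy hu, h.lift_fderiv hy hv,
    curvatureTensor_christoffelCLM (h.metric_source.differentiableAt_christoffelCLM hy),
    curvatureTensor_christoffelCLM
      (h.metric_target.differentiableAt_christoffelCLM (h.mapsTo hy))] at hW
  have hWW : 0 ≤ G y W W := by
    by_cases h0 : W = 0
    · simp [h0]
    · exact (h.metric_source.pos y hy W h0).le
  linarith

end IsRiemannianSubmersionOn

end LocalSubmersion

section ChartExpressions

/-! ### The metric in the preferred charts -/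

variable {E : Type*} [NormedAddCommGroup E] [NormedSpace ℝ E]
  {M : Type*} [TopologicalSpace M] [ChartedSpace E M] [IsManifold 𝓘(ℝ, E) ∞ M]

theorem mfderiv_extChartAt_symm_mfderiv_extChartAt {x z : M}
    (hz : z ∈ (extChartAt 𝓘(ℝ, E) x).source) (u : TangentSpace 𝓘(ℝ, E) z) :
    (mfderiv 𝓘(ℝ, E) 𝓘(ℝ, E) (extChartAt 𝓘(ℝ, E) x).symm (extChartAt 𝓘(ℝ, E) x z)
      (mfderiv 𝓘(ℝ, E) 𝓘(ℝ, E) (extChartAt 𝓘(ℝ, E) x) z u) : E) = u := by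
  have : IsManifold 𝓘(ℝ, E) 1 M := .of_le (n := ∞) (by simp)
  have h := mfderivWithin_extChartAt_symm_comp_mfderiv_extChartAt' (I := 𝓘(ℝ, E)) hz
  rw [modelWithCornersSelf_coe, Set.range_id, mfderivWithin_univ] at h
  exact congrArg (fun L : E →L[ℝ] E ↦ L u) h

theorem mfderiv_extChartAt_mfderiv_extChartAt_symm {x : M} {y : E}
    (hy : y ∈ (extChartAt 𝓘(ℝ, E) x).target) (v : E) :
    (mfderiv 𝓘(ℝ, E) 𝓘(ℝ, E) (extChartAt 𝓘(ℝ, E) x) ((extChartAt 𝓘(ℝ, E) x).symm y)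
      (mfderiv 𝓘(ℝ, E) 𝓘(ℝ, E) (extChartAt 𝓘(ℝ, E) x).symm y v) : E) = v := by
  have : IsManifold 𝓘(ℝ, E) 1 M := .of_le (n := ∞) (by simp)
  have h := mfderiv_extChartAt_comp_mfderivWithin_extChartAt_symm (I := 𝓘(ℝ, E)) hy
  rw [modelWithCornersSelf_coe, Set.range_id, mfderivWithin_univ] at h
  exact congrArg (fun L : E →L[ℝ] E ↦ L v) h

theorem bijective_mfderiv_extChartAt {x z : M} (hz : z ∈ (extChartAt 𝓘(ℝ, E) x).source) :
    Function.Bijective (mfderiv 𝓘(ℝ, E) 𝓘(ℝ, E) (extChartAt 𝓘(ℝ, E) x) z) := by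
  have : IsManifold 𝓘(ℝ, E) 1 M := .of_le (n := ∞) (by simp)
  exact (isInvertible_mfderiv_extChartAt hz).bijective

/-- The chart around `x` is an isometry from `g` to `chartMetric g x` on its whole domain. -/
theorem chartMetric_apply (g : Metric E M) {x z : M}
    (hz : z ∈ (extChartAt 𝓘(ℝ, E) x).source) (u v : TangentSpace 𝓘(ℝ, E) z) :
    chartMetric g x (extChartAt 𝓘(ℝ, E) x z)
      (mfderiv 𝓘(ℝ, E) 𝓘(ℝ, E) (extChartAt 𝓘(ℝ, E) x) z u)
      (mfderiv 𝓘(ℝ, E) 𝓘(ℝ, E) (extChartAt 𝓘(ℝ, E) x) z v) = g.inner z u v := by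
  -- the tangent spaces at `z` and at `φ⁻¹ (φ z)` are different types, both equal to `E`
  have hcongr (z' : M) (h : z' = z) (s t s' t' : E) (hs : s = s') (ht : t = t') :
      (g.inner z' : E →L[ℝ] E →L[ℝ] ℝ) s t = (g.inner z : E →L[ℝ] E →L[ℝ] ℝ) s' t' := by
    subst h hs ht
    rfl
  exact hcongr _ ((extChartAt 𝓘(ℝ, E) x).left_inv hz) _ _ _ _
    (mfderiv_extChartAt_symm_mfderiv_extChartAt hz u)
    (mfderiv_extChartAt_symm_mfderiv_extChartAt hz v)

/-- The coordinate vector fields of a chart are smooth: in the trivialization of the tangent bundle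
given by the same chart they are constant. -/
theorem contMDiffOn_mfderiv_extChartAt_symm (x : M) (v : E) :
    ContMDiffOn 𝓘(ℝ, E) (𝓘(ℝ, E).prod 𝓘(ℝ, E)) ∞
      (fun y : E ↦ Bundle.TotalSpace.mk' E (E := fun x : M ↦ TangentSpace 𝓘(ℝ, E) x)
        ((extChartAt 𝓘(ℝ, E) x).symm y)
        (mfderiv 𝓘(ℝ, E) 𝓘(ℝ, E) (extChartAt 𝓘(ℝ, E) x).symm y v))
      (extChartAt 𝓘(ℝ, E) x).target := by
  have : IsManifold 𝓘(ℝ, E) 1 M := .of_le (n := ∞) (by simp)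
  have hmem : ∀ y ∈ (extChartAt 𝓘(ℝ, E) x).target,
      (extChartAt 𝓘(ℝ, E) x).symm y ∈ (chartAt E x).source := by
    intro y hy
    simpa using (extChartAt 𝓘(ℝ, E) x).map_target hy
  rw [(trivializationAt E (fun x : M ↦ TangentSpace 𝓘(ℝ, E) x) x).contMDiffOn_iff]
  · refine ⟨contMDiffOn_extChartAt_symm x, (contMDiffOn_const (c := v)).congr fun y hy ↦ ?_⟩
    have h1 := TangentBundle.continuousLinearMapAt_trivializationAt (I := 𝓘(ℝ, E)) (hmem y hy)
    have h2 := mfderiv_extChartAt_mfderiv_extChartAt_symm hy v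
    have h3 (w : TangentSpace 𝓘(ℝ, E) ((extChartAt 𝓘(ℝ, E) x).symm y)) :
        ((trivializationAt E (fun x : M ↦ TangentSpace 𝓘(ℝ, E) x) x)
          ⟨(extChartAt 𝓘(ℝ, E) x).symm y, w⟩).2
        = (trivializationAt E (fun x : M ↦ TangentSpace 𝓘(ℝ, E) x) x).continuousLinearMapAt ℝ
          ((extChartAt 𝓘(ℝ, E) x).symm y) w := by
      rw [Bundle.Trivialization.continuousLinearMapAt_apply,
        Bundle.Trivialization.linearMapAt_apply, if_pos]
      exact hmem y hy
    exact (h3 _).trans ((congrArg (fun L : E →L[ℝ] E ↦ L _) h1).trans h2)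
  · intro y hy
    rw [Bundle.Trivialization.mem_source]
    exact hmem y hy

theorem isMetricOn_chartMetric [FiniteDimensional ℝ E] (g : Metric E M) (x : M) :
    IsMetricOn (chartMetric g x) (extChartAt 𝓘(ℝ, E) x).target where
  isOpen := isOpen_extChartAt_target x
  contDiffOn := by
    rw [contDiffOn_clm_apply]
    intro u
    rw [contDiffOn_clm_apply]
    intro v
    rw [← contMDiffOn_iff_contDiffOn]
    have h1 : ContMDiffOn 𝓘(ℝ, E) (𝓘(ℝ, E).prod 𝓘(ℝ, E →L[ℝ] E →L[ℝ] ℝ)) ∞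
        (fun y : E ↦ Bundle.TotalSpace.mk' (E →L[ℝ] E →L[ℝ] ℝ)
          (E := fun x : M ↦ TangentSpace 𝓘(ℝ, E) x →L[ℝ] TangentSpace 𝓘(ℝ, E) x →L[ℝ] ℝ)
          ((extChartAt 𝓘(ℝ, E) x).symm y) (g.inner ((extChartAt 𝓘(ℝ, E) x).symm y)))
        (extChartAt 𝓘(ℝ, E) x).target :=
      g.contMDiff.comp_contMDiffOn (contMDiffOn_extChartAt_symm x)
    have h2 := ContMDiffOn.clm_bundle_apply₂ (F₁ := E) (F₂ := E) (F₃ := ℝ)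
      (E₁ := fun x : M ↦ TangentSpace 𝓘(ℝ, E) x) (E₂ := fun x : M ↦ TangentSpace 𝓘(ℝ, E) x)
      (E₃ := Bundle.Trivial M ℝ) h1
      (contMDiffOn_mfderiv_extChartAt_symm x u) (contMDiffOn_mfderiv_extChartAt_symm x v)
    intro y hy
    have h3 := h2 y hy
    rw [Bundle.contMDiffWithinAt_totalSpace] at h3
    exact h3.2
  symm y _ u v := g.symm _ _ _
  pos y hy u hu := by
    obtain ⟨z, hz, rfl⟩ : ∃ z ∈ (extChartAt 𝓘(ℝ, E) x).source, extChartAt 𝓘(ℝ, E) x z = y :=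
      ⟨_, (extChartAt 𝓘(ℝ, E) x).map_target hy, (extChartAt 𝓘(ℝ, E) x).right_inv hy⟩
    obtain ⟨u', rfl⟩ := (bijective_mfderiv_extChartAt hz).surjective u
    rw [chartMetric_apply g hz]
    refine g.pos z u' ?_
    rintro rfl
    exact hu (map_zero _)

end ChartExpressions

section Gram

/-! ### Planes in tangent spaces -/

variable {E : Type*} [NormedAddCommGroup E] [NormedSpace ℝ E]
  {M : Type*} [TopologicalSpace M] [ChartedSpace E M] [IsManifold 𝓘(ℝ, E) ∞ M]

/-- The strict Cauchy-Schwarz inequality: the Gram determinant of two linearly independent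
tangent vectors is positive. -/
theorem gram_pos (g : Metric E M) {x : M} {u v : TangentSpace 𝓘(ℝ, E) x}
    (h : LinearIndependent ℝ ![u, v]) :
    0 < g.inner x u u * g.inner x v v - g.inner x u v ^ 2 := by
  have hv : v ≠ 0 := h.ne_zero 1
  have hvv := g.pos x v hv
  have hne : g.inner x v v • u - g.inner x u v • v ≠ 0 := by
    intro h0
    have := LinearIndependent.pair_iff.1 h (g.inner x v v) (-g.inner x u v)
      (by rw [neg_smul, ← sub_eq_add_neg, h0])
    exact hvv.ne' this.1
  have hpos := g.pos x _ hne
  simp only [map_sub, map_smul, sub_apply, smul_apply,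
    smul_eq_mul, g.symm x v u] at hpos
  have : 0 < g.inner x v v * (g.inner x u u * g.inner x v v - g.inner x u v ^ 2) := by
    linarith
  exact pos_of_mul_pos_right this hvv.le

/-- The differential of `π` is injective on the horizontal space. -/
theorem linearIndependent_mfderiv_of_horizontal
    {F : Type*} [NormedAddCommGroup F] [NormedSpace ℝ F]
    {B : Type*} [TopologicalSpace B] [ChartedSpace F B]
    {gX : Metric E M} {π : M → B} {x : M} {u v : TangentSpace 𝓘(ℝ, E) x}
    (hu : u ∈ horizontalSpace F gX π x) (hv : v ∈ horizontalSpace F gX π x)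
    (h : LinearIndependent ℝ ![u, v]) :
    LinearIndependent ℝ ![mfderiv 𝓘(ℝ, E) 𝓘(ℝ, F) π x u, mfderiv 𝓘(ℝ, E) 𝓘(ℝ, F) π x v] := by
  rw [LinearIndependent.pair_iff] at h ⊢
  intro s t hst
  refine h s t ?_
  by_contra hne
  have hmem : s • u + t • v ∈ horizontalSpace F gX π x :=
    add_mem (Submodule.smul_mem _ s hu) (Submodule.smul_mem _ t hv)
  have hzero : mfderiv 𝓘(ℝ, E) 𝓘(ℝ, F) π x (s • u + t • v) = 0 := by
    rw [map_add, map_smul, map_smul, hst]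
  exact (gX.pos x _ hne).ne' (hmem _ hzero)

end Gram

section ChartMap

/-! ### Riemannian submersions in the preferred charts -/

/-- The expression of the map `π` in the preferred charts around `x` and `π x`. -/
noncomputable def chartMap (E F : Type*) [NormedAddCommGroup E] [NormedSpace ℝ E]
    [NormedAddCommGroup F] [NormedSpace ℝ F] {X B : Type*} [TopologicalSpace X]
    [ChartedSpace E X] [TopologicalSpace B] [ChartedSpace F B] (π : X → B) (x : X) : E → F :=
  extChartAt 𝓘(ℝ, F) (π x) ∘ π ∘ (extChartAt 𝓘(ℝ, E) x).symm

/-- The domain of `chartMap E F π x`, where the chart expression of `π` is meaningful. -/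
def chartMapDomain (E F : Type*) [NormedAddCommGroup E] [NormedSpace ℝ E]
    [NormedAddCommGroup F] [NormedSpace ℝ F] {X B : Type*} [TopologicalSpace X]
    [ChartedSpace E X] [TopologicalSpace B] [ChartedSpace F B] (π : X → B) (x : X) : Set E :=
  (extChartAt 𝓘(ℝ, E) x).target ∩
    (extChartAt 𝓘(ℝ, E) x).symm ⁻¹' (π ⁻¹' (extChartAt 𝓘(ℝ, F) (π x)).source)

variable {E : Type*} [NormedAddCommGroup E] [NormedSpace ℝ E]
  {X : Type*} [TopologicalSpace X] [ChartedSpace E X]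
  {F : Type*} [NormedAddCommGroup F] [NormedSpace ℝ F]
  {B : Type*} [TopologicalSpace B] [ChartedSpace F B] {π : X → B}

theorem chartMap_extChartAt {x z : X} (hz : z ∈ (extChartAt 𝓘(ℝ, E) x).source) :
    chartMap E F π x (extChartAt 𝓘(ℝ, E) x z) = extChartAt 𝓘(ℝ, F) (π x) (π z) := by
  simp only [chartMap, Function.comp_apply, (extChartAt 𝓘(ℝ, E) x).left_inv hz]

theorem exists_eq_extChartAt {x : X} {y : E} (hy : y ∈ chartMapDomain E F π x) :
    ∃ z ∈ (extChartAt 𝓘(ℝ, E) x).source, π z ∈ (extChartAt 𝓘(ℝ, F) (π x)).source ∧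
      extChartAt 𝓘(ℝ, E) x z = y :=
  ⟨_, (extChartAt 𝓘(ℝ, E) x).map_target hy.1, hy.2, (extChartAt 𝓘(ℝ, E) x).right_inv hy.1⟩

theorem extChartAt_mem_chartMapDomain {x z : X} (hz : z ∈ (extChartAt 𝓘(ℝ, E) x).source)
    (hz' : π z ∈ (extChartAt 𝓘(ℝ, F) (π x)).source) :
    extChartAt 𝓘(ℝ, E) x z ∈ chartMapDomain E F π x := by
  refine ⟨(extChartAt 𝓘(ℝ, E) x).map_source hz, ?_⟩
  rwa [Set.mem_preimage, (extChartAt 𝓘(ℝ, E) x).left_inv hz]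

end ChartMap

section Submersion

variable {E : Type*} [NormedAddCommGroup E] [NormedSpace ℝ E]
  {X : Type*} [TopologicalSpace X] [ChartedSpace E X] [IsManifold 𝓘(ℝ, E) ∞ X]
  {F : Type*} [NormedAddCommGroup F] [NormedSpace ℝ F]
  {B : Type*} [TopologicalSpace B] [ChartedSpace F B] [IsManifold 𝓘(ℝ, F) ∞ B]
  {gX : Metric E X} {gB : Metric F B} {π : X → B}

namespace IsRiemannianSubmersion

theorem isOpen_chartMapDomain (hπ : IsRiemannianSubmersion gX gB π) (x : X) :
    IsOpen (chartMapDomain E F π x) :=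
  (continuousOn_extChartAt_symm x).isOpen_inter_preimage (isOpen_extChartAt_target x)
    ((isOpen_extChartAt_source (π x)).preimage hπ.contMDiff.continuous)

theorem contDiffOn_chartMap (hπ : IsRiemannianSubmersion gX gB π) (x : X) :
    ContDiffOn ℝ ∞ (chartMap E F π x) (chartMapDomain E F π x) := by
  rw [← contMDiffOn_iff_contDiffOn]
  refine (contMDiffOn_extChartAt (n := ∞) (x := π x)).comp (t := (chartAt F (π x)).source)
    (hπ.contMDiff.comp_contMDiffOn
      ((contMDiffOn_extChartAt_symm x).mono Set.inter_subset_left)) ?_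
  intro y hy
  simpa using hy.2

theorem fderiv_chartMap (hπ : IsRiemannianSubmersion gX gB π) {x z : X}
    (hz : z ∈ (extChartAt 𝓘(ℝ, E) x).source) (hz' : π z ∈ (extChartAt 𝓘(ℝ, F) (π x)).source)
    (w : TangentSpace 𝓘(ℝ, E) z) :
    fderiv ℝ (chartMap E F π x) (extChartAt 𝓘(ℝ, E) x z)
        (mfderiv 𝓘(ℝ, E) 𝓘(ℝ, E) (extChartAt 𝓘(ℝ, E) x) z w)
      = mfderiv 𝓘(ℝ, F) 𝓘(ℝ, F) (extChartAt 𝓘(ℝ, F) (π x)) (π z)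
        (mfderiv 𝓘(ℝ, E) 𝓘(ℝ, F) π z w) := by
  have : IsManifold 𝓘(ℝ, E) 1 X := .of_le (n := ∞) (by simp)
  have : IsManifold 𝓘(ℝ, F) 1 B := .of_le (n := ∞) (by simp)
  have hd : MDifferentiableAt 𝓘(ℝ, E) 𝓘(ℝ, F) (chartMap E F π x) (extChartAt 𝓘(ℝ, E) x z) :=
    (((hπ.contDiffOn_chartMap x).contDiffAt ((hπ.isOpen_chartMapDomain x).mem_nhds
      (extChartAt_mem_chartMapDomain hz hz'))).differentiableAt (by simp)).mdifferentiableAt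
  have hφ : MDifferentiableAt 𝓘(ℝ, E) 𝓘(ℝ, E) (extChartAt 𝓘(ℝ, E) x) z :=
    mdifferentiableAt_extChartAt (by simpa using hz)
  have hψ : MDifferentiableAt 𝓘(ℝ, F) 𝓘(ℝ, F) (extChartAt 𝓘(ℝ, F) (π x)) (π z) :=
    mdifferentiableAt_extChartAt (by simpa using hz')
  have h1 := mfderiv_comp z hd hφ
  have h2 := mfderiv_comp z hψ (hπ.contMDiff.mdifferentiableAt (by simp))
  have h3 : chartMap E F π x ∘ extChartAt 𝓘(ℝ, E) x =ᶠ[nhds z] extChartAt 𝓘(ℝ, F) (π x) ∘ π :=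
    Filter.eventuallyEq_of_mem ((isOpen_extChartAt_source x).mem_nhds hz)
      fun z' hz' ↦ chartMap_extChartAt hz'
  have h4 := h3.mfderiv_eq (I := 𝓘(ℝ, E)) (I' := 𝓘(ℝ, F))
  rw [← mfderiv_eq_fderiv]
  exact congrArg (fun L : E →L[ℝ] F ↦ L w) (h1.symm.trans (h4.trans h2))

/-- Horizontality in the charts agrees with horizontality on the manifold. -/
theorem horizontal_iff (hπ : IsRiemannianSubmersion gX gB π) {x z : X}
    (hz : z ∈ (extChartAt 𝓘(ℝ, E) x).source) (hz' : π z ∈ (extChartAt 𝓘(ℝ, F) (π x)).source)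
    (u : TangentSpace 𝓘(ℝ, E) z) :
    (∀ w, fderiv ℝ (chartMap E F π x) (extChartAt 𝓘(ℝ, E) x z) w = 0 →
      chartMetric gX x (extChartAt 𝓘(ℝ, E) x z)
        (mfderiv 𝓘(ℝ, E) 𝓘(ℝ, E) (extChartAt 𝓘(ℝ, E) x) z u) w = 0)
      ↔ u ∈ horizontalSpace F gX π z := by
  have h0 (w : TangentSpace 𝓘(ℝ, E) z) : fderiv ℝ (chartMap E F π x) (extChartAt 𝓘(ℝ, E) x z)
      (mfderiv 𝓘(ℝ, E) 𝓘(ℝ, E) (extChartAt 𝓘(ℝ, E) x) z w) = 0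
      ↔ mfderiv 𝓘(ℝ, E) 𝓘(ℝ, F) π z w = 0 := by
    rw [hπ.fderiv_chartMap hz hz']
    exact map_eq_zero_iff _ (bijective_mfderiv_extChartAt hz').injective
  constructor
  · intro h w hw
    rw [← chartMetric_apply gX hz]
    exact h _ ((h0 w).2 hw)
  · intro h w hw
    obtain ⟨w, rfl⟩ := (bijective_mfderiv_extChartAt hz).surjective w
    rw [chartMetric_apply gX hz]
    exact h w ((h0 w).1 hw)

theorem isRiemannianSubmersionOn_chartMap [FiniteDimensional ℝ E] [FiniteDimensional ℝ F]
    (hπ : IsRiemannianSubmersion gX gB π) (x : X) :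
    IsRiemannianSubmersionOn (chartMetric gX x) (chartMapDomain E F π x)
      (chartMetric gB (π x)) (extChartAt 𝓘(ℝ, F) (π x)).target (chartMap E F π x) where
  metric_source := (isMetricOn_chartMetric gX x).mono (hπ.isOpen_chartMapDomain x)
    Set.inter_subset_left
  metric_target := isMetricOn_chartMetric gB (π x)
  contDiffOn := hπ.contDiffOn_chartMap x
  mapsTo _ hy := (extChartAt 𝓘(ℝ, F) (π x)).map_source hy.2
  surjective := by
    intro y hy v
    obtain ⟨z, hz, hz', rfl⟩ := exists_eq_extChartAt hy
    obtain ⟨v, rfl⟩ := (bijective_mfderiv_extChartAt hz').surjective v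
    obtain ⟨u, rfl⟩ := hπ.surjective_mfderiv z v
    exact ⟨_, hπ.fderiv_chartMap hz hz' u⟩
  isometric := by
    intro y hy u v hu hv
    obtain ⟨z, hz, hz', rfl⟩ := exists_eq_extChartAt hy
    obtain ⟨u, rfl⟩ := (bijective_mfderiv_extChartAt hz).surjective u
    obtain ⟨v, rfl⟩ := (bijective_mfderiv_extChartAt hz).surjective v
    rw [hπ.fderiv_chartMap hz hz', hπ.fderiv_chartMap hz hz', chartMap_extChartAt hz,
      chartMetric_apply gB hz', chartMetric_apply gX hz]
    exact hπ.inner_mfderiv z u ((hπ.horizontal_iff hz hz' u).1 hu) v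
      ((hπ.horizontal_iff hz hz' v).1 hv)

/-- O'Neill's inequality between the curvature forms of `X` and `B`. -/
theorem curvatureForm_le [FiniteDimensional ℝ E] [FiniteDimensional ℝ F]
    (hπ : IsRiemannianSubmersion gX gB π) {x : X} {u v : TangentSpace 𝓘(ℝ, E) x}
    (hu : u ∈ horizontalSpace F gX π x) (hv : v ∈ horizontalSpace F gX π x) :
    curvatureForm gX x u v ≤ curvatureForm gB (π x) (mfderiv 𝓘(ℝ, E) 𝓘(ℝ, F) π x u)
      (mfderiv 𝓘(ℝ, E) 𝓘(ℝ, F) π x v) := by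
  have hx := mem_extChartAt_source (I := 𝓘(ℝ, E)) x
  have hx' := mem_extChartAt_source (I := 𝓘(ℝ, F)) (π x)
  have h := (hπ.isRiemannianSubmersionOn_chartMap x).inner_chartCurvature_le
    (extChartAt_mem_chartMapDomain hx hx')
    ((hπ.horizontal_iff hx hx' u).2 hu) ((hπ.horizontal_iff hx hx' v).2 hv)
  rw [hπ.fderiv_chartMap hx hx', hπ.fderiv_chartMap hx hx', chartMap_extChartAt hx] at h
  exact h

end IsRiemannianSubmersion

end Submersion

end RiemannianGeometry

theorem proposition1
    {E : Type*} [NormedAddCommGroup E] [NormedSpace ℝ E] [FiniteDimensional ℝ E]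
    {X : Type*} [TopologicalSpace X] [ChartedSpace E X] [IsManifold 𝓘(ℝ, E) ∞ X]
    {F : Type*} [NormedAddCommGroup F] [NormedSpace ℝ F] [FiniteDimensional ℝ F]
    {B : Type*} [TopologicalSpace B] [ChartedSpace F B] [IsManifold 𝓘(ℝ, F) ∞ B]
    (gX : RiemannianGeometry.Metric E X) (gB : RiemannianGeometry.Metric F B)
    (π : X → B) (hπ : RiemannianGeometry.IsRiemannianSubmersion gX gB π)
    (hB : RiemannianGeometry.NonposSectionalCurvature gB) :
    ∀ (x : X), ∀ u ∈ RiemannianGeometry.horizontalSpace F gX π x,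
      ∀ v ∈ RiemannianGeometry.horizontalSpace F gX π x,
        LinearIndependent ℝ ![u, v] → RiemannianGeometry.sectionalCurvature gX x u v ≤ 0 := by
  intro x u hu v hv huv
  have hlin := RiemannianGeometry.linearIndependent_mfderiv_of_horizontal hu hv huv
  have hcurv := hB (π x) _ _ hlin
  rw [RiemannianGeometry.sectionalCurvature,
    div_le_iff₀ (RiemannianGeometry.gram_pos gB hlin), zero_mul] at hcurv
  exact div_nonpos_of_nonpos_of_nonneg ((hπ.curvatureForm_le hu hv).trans hcurv)
    (RiemannianGeometry.gram_pos gX huv).le
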